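/- Let $J\ge 1$, $d,p\ge 0$ be integers, $s_1,\dots,s_J\in\mathbb{R}^d$, and $g:\mathbb{R}^d\times\mathbb{R}^p\to\mathbb{R}^p$ (as many moment conditions as parameters: the just-identified case $r=p$). Write $\Delta^{J-1}=\{\theta=(\theta_1,\dots,\theta_{J-1})'\in\mathbb{R}^{J-1}:\theta_j>0 \text{ for } 1\le j\le J\}$ with $\theta_J=1-\sum_{j<J}\theta_j$. Let $\Theta_\beta\subseteq\mathbb{R}^p$ and $\Theta_\theta\subseteq\Delta^{J-1}$ be Borel sets and $$\Theta_{\beta,\theta}=\Big\{(\beta,\theta)\in\Theta_\beta\times\Theta_\theta:\ \sum_{j=1}^J\theta_j\,g(s_j,\beta)=0\Big\}\subseteq\mathbb{R}^{p+J-1}.$$ Assume that each $g(s_j,\cdot)$ is $C^1$ in a neighbourhood of every point of $\Theta_\beta$ and that the $p\times p$ matrix $\mathbb{E}_\theta(\partial g/\partial\beta')=\sum_{j=1}^J\theta_j\,\partial g(s_j,\beta)/\partial\beta'$ is invertible at every $(\beta,\theta)\in\Theta_{\beta,\theta}$. Assume that $\beta$ is uniquely determined by $\theta$: for every $\theta\in\Theta_\theta$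 there is exactly one $\beta=\beta(\theta)$ with $(\beta,\theta)\in\Theta_{\beta,\theta}$. With $g_j=g(s_j,\beta)$ and $\iota$ the $(J-1)$-vector of ones, put $$H_\beta=(g_1,\dots,g_{J-1})-g_J\iota',\qquad J_\theta=-\Big\{\mathbb{E}_\theta\Big(\frac{\partial g}{\partial\beta'}\Big)\Big\}^{-1}H_\beta,\quad\text{evaluated at }\beta=\beta(\theta).$$ Let $(\beta,\theta)$ be distributed according to a measure (for instance the prior or the posterior) with density $p(\beta,\theta)$ with respect to the $(J-1)$-dimensional Hausdorff measure on $\Theta_{\beta,\theta}$, normalized so that on $\mathbb{R}^{J-1}$ it is Lebesgue measure. Then: (i) $J_\theta=\partial\beta/\partial\theta'$: at every $\theta\in\Theta_\theta$ such that $\beta(\theta)$ is an interior point of $\Theta_\beta$ (so at every $\theta\in\Theta_\theta$ if $\Theta_\beta$ is open), or such that the map $\beta(\cdot)$ is continuous at $\theta$ relative to $\Theta_\theta$, this map is differentiable at $\theta$ relative to $\Theta_\theta$ with derivative matrix $J_\theta$; (ii) the marginal distribution of $\theta$ has the density $$p(\theta)=\sqrt{\left|J_\theta J_\theta'+I_p\right|}\;p(\beta(\theta),\theta),\qquad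 \theta\in\Theta_\theta,$$ and $p(\theta)=0$ for $\theta\notin\Theta_\theta$, with respect to Lebesgue measure on $\mathbb{R}^{J-1}$. -/

import Mathlib

open MeasureTheory
open scoped ENNReal

namespace MomentModel

/-- `ℝⁿ` with its Euclidean norm. -/
abbrev Vec (n : ℕ) : Type := EuclideanSpace ℝ (Fin n)

/-- The joint space `ℝᵖ × ℝᵐ = ℝᵖ⁺ᵐ` of pairs `(β, θ)`, with its Euclidean norm. -/
abbrev Joint (p m : ℕ) : Type := WithLp 2 (Vec p × Vec m)

/-- The pair `(β, θ)`. -/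
abbrev mkPair {p m : ℕ} (b : Vec p) (θ : Vec m) : Joint p m := WithLp.toLp 2 (b, θ)

/-- The `J = m + 1` probabilities `(θ₁, …, θ_{J-1}, θ_J)` with `θ_J = 1 - (θ₁ + ⋯ + θ_{J-1})`. -/
noncomputable def prob {m : ℕ} (θ : Vec m) : Fin (m + 1) → ℝ :=
  Fin.snoc (α := fun _ => ℝ) (fun j => θ j) (1 - ∑ j, θ j)

/-- The open simplex `Δᴶ⁻¹`, in the coordinates `θ₁, …, θ_{J-1}`. -/
def simplex (m : ℕ) : Set (Vec m) := {θ | ∀ j, 0 < prob θ j}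

/-- The set of admissible pairs: `β ∈ B`, `θ ∈ T` and `∑ⱼ θⱼ g(sⱼ, β) = 0`. -/
def constraintSet {d p m : ℕ} (s : Fin (m + 1) → Vec d) (g : Vec d → Vec p → Vec p)
    (B : Set (Vec p)) (T : Set (Vec m)) : Set (Joint p m) :=
  {x | x.fst ∈ B ∧ x.snd ∈ T ∧ ∑ j, prob x.snd j • g (s j) x.fst = 0}

/-- The Jacobian matrix `∂f/∂β'` of `f` at `b`: the entry `(i, k)` is `∂fᵢ/∂βₖ`. -/
noncomputable def jacobian {p q : ℕ} (f : Vec p → Vec q) (b : Vec p) :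
    Matrix (Fin q) (Fin p) ℝ :=
  Matrix.of fun i k => fderiv ℝ f b (EuclideanSpace.single k 1) i

/-- `E_θ(∂g/∂β') = ∑ⱼ θⱼ ∂g(sⱼ, β)/∂β'`. -/
noncomputable def meanJacobian {d p m : ℕ} (s : Fin (m + 1) → Vec d) (g : Vec d → Vec p → Vec p)
    (b : Vec p) (θ : Vec m) : Matrix (Fin p) (Fin p) ℝ :=
  ∑ j, prob θ j • jacobian (g (s j)) b

/-- `H_β = (g₁, …, g_{J-1}) - g_J ι'`, where `gⱼ = g(sⱼ, β)`. -/
noncomputable def Hmat {d p m : ℕ} (s : Fin (m + 1) → Vec d) (g : Vec d → Vec p → Vec p)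
    (b : Vec p) : Matrix (Fin p) (Fin m) ℝ :=
  Matrix.of fun i j => g (s j.castSucc) b i - g (s (Fin.last m)) b i

/-- `J_θ = -{E_θ(∂g/∂β')}⁻¹ H_β`. -/
noncomputable def Jmat {d p m : ℕ} (s : Fin (m + 1) → Vec d) (g : Vec d → Vec p → Vec p)
    (b : Vec p) (θ : Vec m) : Matrix (Fin p) (Fin m) ℝ :=
  -((meanJacobian s g b θ)⁻¹ * Hmat s g b)

/-- `f` is a (real, nonnegative) density of the measure `μ` with respect to the measure `ν`. -/
def HasDensity {X : Type*} [MeasurableSpace X] (μ ν : Measure X) (f : X → ℝ) : Prop :=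
  AEMeasurable f ν ∧ 0 ≤ᵐ[ν] f ∧ μ = ν.withDensity fun x => ENNReal.ofReal (f x)

end MomentModel

/-! The admissible pairs are zeros of the mean moment G(β, θ) = ∑ θ_j g(s_j, β), whose partial
derivatives are E = E_θ(∂g/∂β') and H_β. Strict differentiability of G at a zero x₀ gives E Δβ + H_β
Δθ = o(|Δβ| + |Δθ|) for the difference of any two zeros near x₀, and invertibility of E turns this
into Δβ = J_θ Δθ + o(|Δθ|), with E, H_β, J_θ taken at x₀ (`eventually_norm_sub_Jmat_le`).

With one zero fixed at x₀, this is differentiability of β(·) wherever β(·) is continuous; at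
interior points continuity comes from local openness of (G, θ). With both zeros free, the zero set
near x₀ is, up to a factor 1 + δ in distances, the graph of a linear map, whose Hausdorff measure is
√|JJ' + I| times the volume of its projection. Localizing and letting the distortion tend to 1
yields the area formula `euclideanHausdorffMeasure_restrict_constraintSet`; the marginal density
follows by change of variables. No continuity of β(·) is needed here: measurability comes from the
injective projection to θ. -/

section

open Module Filter Topology Set

/-! ### Hausdorff measure under nearly isometric maps, and local comparison of measures -/

section Hausdorff

variable {X Y : Type*} [MetricSpace X] [MeasurableSpace X] [BorelSpace X]
  [MetricSpace Y] [MeasurableSpace Y] [BorelSpace Y]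

theorem LipschitzOnWith.euclideanHausdorffMeasure_image_le {K : NNReal} {f : X → Y} {s : Set X}
    (h : LipschitzOnWith K f s) (n : ℕ) : μHE[n] (f '' s) ≤ (K : ℝ≥0∞) ^ n * μHE[n] s := by
  simp only [Measure.euclideanHausdorffMeasure_def, Measure.smul_apply, ENNReal.smul_def,
    smul_eq_mul]
  rw [mul_left_comm]
  gcongr
  simpa using h.hausdorffMeasure_image_le (d := n) n.cast_nonneg

theorem euclideanHausdorffMeasure_le_image_of_dist_le {K : NNReal} {f : X → Y} {s : Set X}
    (h : ∀ x ∈ s, ∀ y ∈ s, dist x y ≤ K * dist (f x) (f y)) (n : ℕ) :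
    μHE[n] s ≤ (K : ℝ≥0∞) ^ n * μHE[n] (f '' s) := by
  have hf : AntilipschitzWith K (fun x : s => f x) :=
    AntilipschitzWith.of_le_mul_dist fun x y => h x x.2 y y.2
  have h1 := hf.le_hausdorffMeasure_image (d := n) n.cast_nonneg univ
  have h2 : (fun x : s => f x) '' univ = f '' s := by
    ext; simp
  have h3 := (isometry_subtype_coe (s := s)).hausdorffMeasure_image (d := n)
    (Or.inl n.cast_nonneg) univ
  rw [h2, ← h3] at h1
  simp only [Measure.euclideanHausdorffMeasure_def, Measure.smul_apply, ENNReal.smul_def,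
    smul_eq_mul]
  rw [mul_left_comm]
  gcongr
  simpa using h1

/-- If, locally on `s`, `ν₁ ≤ t • ν₂` for every `t > 1`, then `ν₁ ≤ ν₂` on `s`. -/
theorem MeasureTheory.Measure.restrict_le_of_locally_le_mul [SecondCountableTopology X]
    {ν₁ ν₂ : Measure X} {s : Set X} (hs : MeasurableSet s)
    (h : ∀ t : NNReal, 1 < t → ∀ x ∈ s, ∃ W ∈ 𝓝 x, ∀ A, MeasurableSet A → A ⊆ W ∩ s →
      ν₁ A ≤ t * ν₂ A) : ν₁.restrict s ≤ ν₂.restrict s := by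
  have key : ∀ t : NNReal, 1 < t → ∀ A, MeasurableSet A → A ⊆ s → ν₁ A ≤ t * ν₂ A := by
    intro t ht A hA hAs
    rcases s.eq_empty_or_nonempty with rfl | hne
    · simp [subset_empty_iff.1 hAs]
    choose! W hW hWA using h t ht
    obtain ⟨u, hus, huc, hcov⟩ := TopologicalSpace.countable_cover_nhdsWithin
      (f := fun x => interior (W x)) (s := s)
      (fun x hx => mem_nhdsWithin_of_mem_nhds (interior_mem_nhds.2 (hW x hx)))
    have hune : u.Nonempty := by
      obtain ⟨x, hx⟩ := hne
      obtain ⟨y, hy, -⟩ := mem_iUnion₂.1 (hcov hx)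
      exact ⟨y, hy⟩
    obtain ⟨e, rfl⟩ := huc.exists_eq_range hune
    let V : ℕ → Set X := fun n => interior (W (e n))
    have hVm : ∀ n, MeasurableSet (disjointed V n) :=
      fun n => MeasurableSet.disjointed (fun n => isOpen_interior.measurableSet) n
    -- By Lindelöf countably many neighbourhoods suffice; making them disjoint lets the local bounds
    -- add up with the same constant t.
    have hAe : A = ⋃ n, A ∩ disjointed V n := by
      rw [← inter_iUnion, iUnion_disjointed, eq_comm, inter_eq_left]
      intro x hx
      simpa [V] using hcov (hAs hx)
    have hd : Pairwise (Function.onFun Disjoint fun n => A ∩ disjointed V n) := fun i j hij =>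
      (disjoint_disjointed V hij).mono inter_subset_right inter_subset_right
    rw [hAe, measure_iUnion hd fun n => hA.inter (hVm n),
      measure_iUnion hd fun n => hA.inter (hVm n), ← ENNReal.tsum_mul_left]
    refine ENNReal.tsum_le_tsum fun n => hWA (e n) (hus (mem_range_self n)) _ (hA.inter (hVm n)) ?_
    exact fun x hx => ⟨interior_subset (disjointed_subset V n hx.2), hAs hx.1⟩
  refine Measure.le_iff.2 fun A hA => ?_
  rw [Measure.restrict_apply hA, Measure.restrict_apply hA]
  have h1 : ∀ᶠ t : NNReal in 𝓝[>] 1, ν₁ (A ∩ s) ≤ t * ν₂ (A ∩ s) :=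
    eventually_nhdsWithin_of_forall fun t ht => key t ht _ (hA.inter hs) inter_subset_right
  by_cases htop : ν₂ (A ∩ s) = ∞
  · simp [htop]
  have h2 : Tendsto (fun t : NNReal => (t : ℝ≥0∞) * ν₂ (A ∩ s)) (𝓝[>] 1)
      (𝓝 (((1 : NNReal) : ℝ≥0∞) * ν₂ (A ∩ s))) :=
    (ENNReal.Tendsto.mul_const ((ENNReal.continuous_coe.tendsto 1)) (Or.inr htop)).mono_left
      nhdsWithin_le_nhds
  simpa using ge_of_tendsto h2 h1

end Hausdorff

/-! ### Graphs of linear maps and sets close to them -/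

section Graph

variable {E F : Type*} [NormedAddCommGroup E] [NormedAddCommGroup F]

theorem WithLp.norm_snd_le_two (x : WithLp 2 (F × E)) : ‖x.snd‖ ≤ ‖x‖ := by
  rw [WithLp.prod_norm_eq_of_L2]
  exact Real.le_sqrt_of_sq_le (by nlinarith [sq_nonneg ‖x.fst‖])

variable [InnerProductSpace ℝ E] [InnerProductSpace ℝ F]

/-- The parametrization `v ↦ (L v, v)` of the graph of a linear map, in the Euclidean product. -/
def LinearMap.graphMap (L : E →ₗ[ℝ] F) : E →ₗ[ℝ] WithLp 2 (F × E) where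
  toFun v := WithLp.toLp 2 (L v, v)
  map_add' v w := by simp [← WithLp.toLp_add]
  map_smul' a v := by simp [← WithLp.toLp_smul]

theorem LinearMap.graphMap_apply (L : E →ₗ[ℝ] F) (v : E) :
    L.graphMap v = WithLp.toLp 2 (L v, v) := rfl

theorem LinearMap.norm_sub_graphMap (L : E →ₗ[ℝ] F) (x : WithLp 2 (F × E)) :
    ‖x - L.graphMap x.snd‖ = ‖x.fst - L x.snd‖ := by
  rw [WithLp.prod_norm_eq_of_L2]
  simp [LinearMap.graphMap_apply]

variable [FiniteDimensional ℝ E]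

theorem LinearMap.normDet_graphMap_pos (L : E →ₗ[ℝ] F) : 0 < L.graphMap.normDet := by
  refine lt_of_le_of_ne (LinearMap.normDet_nonneg _) fun h => ?_
  refine LinearMap.normDet_eq_zero_iff_ker_ne_bot.1 h.symm (LinearMap.ker_eq_bot.2 fun v w hvw => ?_)
  exact congrArg (fun x : WithLp 2 (F × E) => x.snd) hvw

variable [MeasurableSpace E] [BorelSpace E]
  [MeasurableSpace F] [BorelSpace F]

/-- Comparison of the Hausdorff measure of a set which is nearly the graph of a linear map with
the volume of its projection. -/
theorem euclideanHausdorffMeasure_near_graph (L : E →ₗ[ℝ] F) {δ : NNReal} {s : Set (WithLp 2 (F × E))}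
    (h : ∀ x ∈ s, ∀ y ∈ s,
      ‖(x.fst - y.fst) - L (x.snd - y.snd)‖ ≤ δ * ‖x.snd - y.snd‖) :
    μHE[finrank ℝ E] s ≤ ((1 + δ : NNReal) : ℝ≥0∞) ^ finrank ℝ E *
      (ENNReal.ofReal L.graphMap.normDet * volume ((fun x => x.snd) '' s)) ∧
    ENNReal.ofReal L.graphMap.normDet * volume ((fun x : WithLp 2 (F × E) => x.snd) '' s) ≤
      ((1 + δ : NNReal) : ℝ≥0∞) ^ finrank ℝ E * μHE[finrank ℝ E] s := by
  have hd : ∀ x ∈ s, ∀ y ∈ s, ‖(x - y) - L.graphMap (x - y).snd‖ ≤ δ * ‖(x - y).snd‖ := by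
    intro x hx y hy
    rw [L.norm_sub_graphMap]
    simpa using h x hx y hy
  have himg : (fun x : WithLp 2 (F × E) => L.graphMap x.snd) '' s =
      L.graphMap '' ((fun x : WithLp 2 (F × E) => x.snd) '' s) := by
    rw [image_image]
  rw [← L.graphMap.euclideanHausdorffMeasure_image_eq_normDet_mul_volume, ← himg]
  have hsub : ∀ x y : WithLp 2 (F × E),
      L.graphMap x.snd - L.graphMap y.snd = L.graphMap (x - y).snd := by
    intro x y
    rw [← map_sub]; simp
  constructor
  -- Both bounds compare x - y with its vertical projection onto the graph of L. The error is at
  -- most δ times the norm of the θ-part, which both vectors share and which neither norm is less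
  -- than.
  · refine euclideanHausdorffMeasure_le_image_of_dist_le (fun x hx y hy => ?_) _
    rw [dist_eq_norm, dist_eq_norm, hsub]
    have h1 := hd x hx y hy
    have h2 := norm_sub_norm_le (x - y) (L.graphMap (x - y).snd)
    have h3 := WithLp.norm_snd_le_two (L.graphMap (x - y).snd)
    have h4 : (L.graphMap (x - y).snd).snd = (x - y).snd := rfl
    rw [h4] at h3
    push_cast
    nlinarith [δ.coe_nonneg]
  · refine LipschitzOnWith.euclideanHausdorffMeasure_image_le
      (LipschitzOnWith.of_dist_le_mul fun x hx y hy => ?_) _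
    rw [dist_eq_norm, dist_eq_norm, hsub]
    have h1 := hd x hx y hy
    have h2 := norm_sub_norm_le (L.graphMap (x - y).snd) (x - y)
    have h3 := WithLp.norm_snd_le_two (x - y)
    rw [norm_sub_rev] at h1
    push_cast
    nlinarith [δ.coe_nonneg]

end Graph

/-- The Gram matrix of the graph parametrization is the m × m matrix I + J'J; Sylvester's
determinant identity passes to the p × p matrix JJ' + I. -/
theorem Matrix.normDet_graphMap_toEuclideanLin {p m : ℕ} (J : Matrix (Fin p) (Fin m) ℝ) :
    (Matrix.toEuclideanLin J).graphMap.normDet = √((J * J.transpose + 1).det) := by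
  have h := (Matrix.toEuclideanLin J).graphMap.normDet_sq_eq_det_gram
    (EuclideanSpace.basisFun (Fin m) ℝ)
  have hg : Matrix.gram ℝ (fun j => (Matrix.toEuclideanLin J).graphMap
      (EuclideanSpace.basisFun (Fin m) ℝ j)) = 1 + J.transpose * J := by
    ext i j
    rw [Matrix.gram_apply, LinearMap.graphMap_apply, LinearMap.graphMap_apply,
      WithLp.prod_inner_apply]
    simp [Matrix.mul_apply, Matrix.one_apply, PiLp.inner_apply, add_comm, mul_comm,
      eq_comm, Matrix.toLpLin_apply]
  rw [hg, Matrix.det_one_add_mul_comm, add_comm] at h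
  rw [← h]
  exact (Real.sqrt_sq (LinearMap.normDet_nonneg _)).symm

/-! ### The mean moment function, its derivative and its regular zeros -/

namespace MomentModel

variable {d p m : ℕ} (s : Fin (m + 1) → Vec d) (g : Vec d → Vec p → Vec p)

/-- The mean moment function `(β, θ) ↦ ∑ⱼ θⱼ g(sⱼ, β)`. -/
noncomputable def moment (x : Joint p m) : Vec p := ∑ j, prob x.snd j • g (s j) x.fst

@[simp] theorem prob_castSucc (θ : Vec m) (j : Fin m) : prob θ j.castSucc = θ j := by
  simp [prob]

@[simp] theorem prob_last (θ : Vec m) : prob θ (Fin.last m) = 1 - ∑ j, θ j := by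
  simp [prob]

/-- The derivative of `θ ↦ prob θ j`. -/
noncomputable def probDeriv (j : Fin (m + 1)) : Vec m →L[ℝ] ℝ :=
  Fin.lastCases (motive := fun _ => Vec m →L[ℝ] ℝ) (-∑ i : Fin m, EuclideanSpace.proj i)
    (fun i => EuclideanSpace.proj i) j

theorem hasStrictFDerivAt_prob (j : Fin (m + 1)) (θ : Vec m) :
    HasStrictFDerivAt (fun θ : Vec m => prob θ j) (probDeriv j) θ := by
  refine Fin.lastCases ?_ (fun i => ?_) j
  · simp only [prob_last, probDeriv, Fin.lastCases_last]
    exact (HasStrictFDerivAt.fun_sum fun i _ =>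
      (EuclideanSpace.proj i : Vec m →L[ℝ] ℝ).hasStrictFDerivAt).const_sub 1
  · simp only [prob_castSucc, probDeriv, Fin.lastCases_castSucc]
    exact (EuclideanSpace.proj i : Vec m →L[ℝ] ℝ).hasStrictFDerivAt

theorem sum_probDeriv_smul (b : Vec p) (θ : Vec m) :
    ∑ j, probDeriv j θ • g (s j) b = Matrix.toEuclideanLin (Hmat s g b) θ := by
  rw [Fin.sum_univ_castSucc]
  ext i
  simp [probDeriv, Hmat, Matrix.toLpLin_apply, Matrix.mulVec, dotProduct, Finset.sum_mul,
    mul_comm, sub_eq_add_neg, mul_add, Finset.sum_add_distrib]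

theorem toEuclideanLin_jacobian {q : ℕ} (f : Vec p → Vec q) (b v : Vec p) :
    Matrix.toEuclideanLin (jacobian f b) v = fderiv ℝ f b v := by
  have h : Matrix.toEuclideanLin (jacobian f b) = (fderiv ℝ f b : Vec p →ₗ[ℝ] Vec q) := by
    refine (EuclideanSpace.basisFun (Fin p) ℝ).toBasis.ext fun k => ?_
    ext i
    simp [jacobian, Matrix.toLpLin_apply]
  exact congrArg (fun l => l v) h

theorem sum_prob_smul_fderiv (b v : Vec p) (θ : Vec m) :
    ∑ j, prob θ j • fderiv ℝ (g (s j)) b v =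
      Matrix.toEuclideanLin (meanJacobian s g b θ) v := by
  simp [meanJacobian, map_sum, toEuclideanLin_jacobian]

/-- The derivative of the mean moment function at `x`. -/
noncomputable def momentDeriv (x : Joint p m) : Joint p m →L[ℝ] Vec p :=
  ∑ j, (prob x.snd j • (fderiv ℝ (g (s j)) x.fst ∘L WithLp.fstL 2 ℝ (Vec p) (Vec m)) +
    (probDeriv j ∘L WithLp.sndL 2 ℝ (Vec p) (Vec m)).smulRight (g (s j) x.fst))

theorem momentDeriv_apply (x v : Joint p m) :
    momentDeriv s g x v = Matrix.toEuclideanLin (meanJacobian s g x.fst x.snd) v.fst +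
      Matrix.toEuclideanLin (Hmat s g x.fst) v.snd := by
  rw [← sum_prob_smul_fderiv, ← sum_probDeriv_smul, ← Finset.sum_add_distrib]
  simp [momentDeriv]

variable {s g}

theorem hasStrictFDerivAt_moment {x : Joint p m} (h : ∀ j, ContDiffAt ℝ 1 (g (s j)) x.fst) :
    HasStrictFDerivAt (moment s g) (momentDeriv s g x) x := by
  refine HasStrictFDerivAt.fun_sum fun j _ => ?_
  have h1 : HasStrictFDerivAt (fun x : Joint p m => prob x.snd j)
      (probDeriv j ∘L WithLp.sndL 2 ℝ (Vec p) (Vec m)) x :=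
    (hasStrictFDerivAt_prob j x.snd).comp x (WithLp.sndL 2 ℝ (Vec p) (Vec m)).hasStrictFDerivAt
  have h2 : HasStrictFDerivAt (fun x : Joint p m => g (s j) x.fst)
      (fderiv ℝ (g (s j)) x.fst ∘L WithLp.fstL 2 ℝ (Vec p) (Vec m)) x :=
    ((h j).hasStrictFDerivAt one_ne_zero).comp x
      (WithLp.fstL 2 ℝ (Vec p) (Vec m)).hasStrictFDerivAt
  exact h1.smul h2

theorem meanJacobian_Jmat_apply {b : Vec p} {θ : Vec m} (hE : IsUnit (meanJacobian s g b θ))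
    (v : Vec m) :
    Matrix.toEuclideanLin (meanJacobian s g b θ) (Matrix.toEuclideanLin (Jmat s g b θ) v) =
      -Matrix.toEuclideanLin (Hmat s g b) v := by
  have h : meanJacobian s g b θ * Jmat s g b θ = -Hmat s g b := by
    rw [Jmat, Matrix.mul_neg, Matrix.mul_nonsing_inv_cancel_left _ _
      ((Matrix.isUnit_iff_isUnit_det _).1 hE)]
  rw [← LinearMap.neg_apply, ← map_neg, ← h]
  simp [Matrix.toLpLin_apply]

theorem exists_norm_le_meanJacobian {b : Vec p} {θ : Vec m}
    (hE : IsUnit (meanJacobian s g b θ)) :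
    ∃ K : ℝ, 0 < K ∧ ∀ v, ‖v‖ ≤ K * ‖Matrix.toEuclideanLin (meanJacobian s g b θ) v‖ := by
  let N := LinearMap.toContinuousLinearMap (Matrix.toEuclideanLin (meanJacobian s g b θ)⁻¹)
  refine ⟨‖N‖ + 1, by positivity, fun v => ?_⟩
  have h1 : N (Matrix.toEuclideanLin (meanJacobian s g b θ) v) = v := by
    simp [N, Matrix.toLpLin_apply, Matrix.nonsing_inv_mul _
      ((Matrix.isUnit_iff_isUnit_det _).1 hE)]
  have h2 := N.le_opNorm (Matrix.toEuclideanLin (meanJacobian s g b θ) v)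
  rw [h1] at h2
  nlinarith [norm_nonneg (Matrix.toEuclideanLin (meanJacobian s g b θ) v)]

theorem surjective_meanJacobian {b : Vec p} {θ : Vec m}
    (hE : IsUnit (meanJacobian s g b θ)) :
    Function.Surjective (Matrix.toEuclideanLin (meanJacobian s g b θ)) := by
  intro v
  refine ⟨Matrix.toEuclideanLin (meanJacobian s g b θ)⁻¹ v, ?_⟩
  simp [Matrix.toLpLin_apply, Matrix.mul_nonsing_inv _
      ((Matrix.isUnit_iff_isUnit_det _).1 hE)]

/-- Near a regular zero, differences of zeros of the mean moment function are nearly on the graph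
of `J_θ`. -/
theorem eventually_norm_sub_Jmat_le {x₀ : Joint p m}
    (hg : ∀ j, ContDiffAt ℝ 1 (g (s j)) x₀.fst)
    (hE : IsUnit (meanJacobian s g x₀.fst x₀.snd)) {δ : ℝ} (hδ : 0 < δ) :
    ∀ᶠ q : Joint p m × Joint p m in 𝓝 (x₀, x₀), moment s g q.1 = 0 → moment s g q.2 = 0 →
      ‖(q.1.fst - q.2.fst) -
          Matrix.toEuclideanLin (Jmat s g x₀.fst x₀.snd) (q.1.snd - q.2.snd)‖ ≤
        δ * ‖q.1.snd - q.2.snd‖ := by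
  obtain ⟨K, hK, hKv⟩ := exists_norm_le_meanJacobian hE
  let L := LinearMap.toContinuousLinearMap (Matrix.toEuclideanLin (Jmat s g x₀.fst x₀.snd))
  have hL : ∀ v, L v = Matrix.toEuclideanLin (Jmat s g x₀.fst x₀.snd) v := fun v => rfl
  have hC : 0 < ‖L‖ + 1 := by positivity
  -- The first bound lets the term in ‖Δb - L Δθ‖ be absorbed on the left at the cost of a factor 2;
  -- the second makes what remains at most δ ‖Δθ‖.
  set ε : ℝ := min (1 / (2 * K)) (δ / (2 * K * (‖L‖ + 1))) with hε
  have hε0 : 0 < ε := by positivity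
  have hε1 : K * ε ≤ 1 / 2 := by
    calc K * ε ≤ K * (1 / (2 * K)) := by gcongr; exact min_le_left _ _
      _ = 1 / 2 := by field_simp
  have hε2 : 2 * (K * ε) * (‖L‖ + 1) ≤ δ := by
    calc 2 * (K * ε) * (‖L‖ + 1) ≤ 2 * (K * (δ / (2 * K * (‖L‖ + 1)))) * (‖L‖ + 1) := by
          gcongr; exact min_le_right _ _
      _ = δ := by field_simp
  have h := (hasStrictFDerivAt_moment hg).isLittleO.bound hε0
  filter_upwards [h] with q hq h1 h2
  rw [h1, h2, sub_zero, zero_sub, norm_neg, momentDeriv_apply] at hq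
  rw [← hL]
  set Δb := q.1.fst - q.2.fst with hb
  set Δθ := q.1.snd - q.2.snd with hθ
  have e1 : (q.1 - q.2).fst = Δb := by simp [hb]
  have e2 : (q.1 - q.2).snd = Δθ := by simp [hθ]
  -- Since E J = -H, the linearized moment equation is E applied to the deviation from the graph of
  -- J.
  have h3 : Matrix.toEuclideanLin (meanJacobian s g x₀.fst x₀.snd) (Δb - L Δθ) =
      Matrix.toEuclideanLin (meanJacobian s g x₀.fst x₀.snd) Δb +
        Matrix.toEuclideanLin (Hmat s g x₀.fst) Δθ := by
    rw [map_sub, hL, meanJacobian_Jmat_apply hE, sub_neg_eq_add]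
  rw [e1, e2, ← h3] at hq
  have h4 := hKv (Δb - L Δθ)
  have h5 : ‖q.1 - q.2‖ ≤ ‖Δb‖ + ‖Δθ‖ := by
    rw [WithLp.prod_norm_eq_of_L2, e1, e2]
    exact Real.sqrt_le_iff.2 ⟨by positivity, by nlinarith [norm_nonneg Δb, norm_nonneg Δθ]⟩
  have h6 : ‖Δb‖ ≤ ‖Δb - L Δθ‖ + ‖L‖ * ‖Δθ‖ := by
    have := norm_add_le (Δb - L Δθ) (L Δθ)
    rw [sub_add_cancel] at this
    linarith [L.le_opNorm Δθ]
  have h7 : ‖Δb - L Δθ‖ ≤ (K * ε) * (‖Δb - L Δθ‖ + (‖L‖ + 1) * ‖Δθ‖) :=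
    calc ‖Δb - L Δθ‖ ≤ K * (ε * ‖q.1 - q.2‖) := h4.trans (by gcongr)
      _ ≤ K * (ε * (‖Δb - L Δθ‖ + (‖L‖ + 1) * ‖Δθ‖)) := by gcongr; linarith
      _ = _ := by ring
  have h8 : (K * ε) * ‖Δb - L Δθ‖ ≤ 1 / 2 * ‖Δb - L Δθ‖ := by gcongr
  have h9 : 2 * (K * ε) * (‖L‖ + 1) * ‖Δθ‖ ≤ δ * ‖Δθ‖ := by gcongr
  linarith

/-! ### The volume factor -/

theorem continuousAt_prob (θ : Vec m) (j : Fin (m + 1)) :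
    ContinuousAt (fun θ : Vec m => prob θ j) θ :=
  (hasStrictFDerivAt_prob j θ).hasFDerivAt.continuousAt

/-- The volume factor `√|J_θ J_θ' + I_p|`. -/
noncomputable def volumeFactor (s : Fin (m + 1) → Vec d) (g : Vec d → Vec p → Vec p)
    (x : Joint p m) : ℝ :=
  √((Jmat s g x.fst x.snd * (Jmat s g x.fst x.snd).transpose + 1).det)

theorem volumeFactor_eq_normDet (x : Joint p m) :
    volumeFactor s g x = (Matrix.toEuclideanLin (Jmat s g x.fst x.snd)).graphMap.normDet :=
  (Matrix.normDet_graphMap_toEuclideanLin _).symm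

theorem volumeFactor_pos (x : Joint p m) : 0 < volumeFactor s g x := by
  rw [volumeFactor_eq_normDet]
  exact LinearMap.normDet_graphMap_pos _

theorem continuousAt_volumeFactor {x : Joint p m}
    (hg : ∀ j, ContDiffAt ℝ 1 (g (s j)) x.fst)
    (hE : IsUnit (meanJacobian s g x.fst x.snd)) : ContinuousAt (volumeFactor s g) x := by
  have hfst : ContinuousAt (fun x : Joint p m => x.fst) x :=
    (WithLp.fstL 2 ℝ (Vec p) (Vec m)).continuous.continuousAt
  have hsnd : ContinuousAt (fun x : Joint p m => x.snd) x :=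
    (WithLp.sndL 2 ℝ (Vec p) (Vec m)).continuous.continuousAt
  have hgc : ∀ j, ContinuousAt (fun x : Joint p m => g (s j) x.fst) x := fun j =>
    (hg j).continuousAt.comp hfst
  have hH : ContinuousAt (fun x : Joint p m => Hmat s g x.fst) x := by
    refine continuousAt_pi.2 fun i => continuousAt_pi.2 fun j => ?_
    exact ((EuclideanSpace.proj (𝕜 := ℝ) i).continuous.continuousAt.comp (hgc j.castSucc)).sub
      ((EuclideanSpace.proj (𝕜 := ℝ) i).continuous.continuousAt.comp (hgc (Fin.last m)))
  have hM : ContinuousAt (fun x : Joint p m => meanJacobian s g x.fst x.snd) x := by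
    refine tendsto_finsetSum _ fun j _ => ?_
    refine ((continuousAt_prob x.snd j).comp hsnd).smul ?_
    refine continuousAt_pi.2 fun i => continuousAt_pi.2 fun k => ?_
    have hd : ContinuousAt (fun x : Joint p m => fderiv ℝ (g (s j)) x.fst) x :=
      ContinuousAt.comp (f := fun x : Joint p m => x.fst)
        (((hg j).fderiv_right (m := 0) (by simp)).continuousAt) hfst
    exact (EuclideanSpace.proj (𝕜 := ℝ) i).continuous.continuousAt.comp
      (hd.clm_apply continuousAt_const)
  have hI : ContinuousAt (fun x : Joint p m => (meanJacobian s g x.fst x.snd)⁻¹) x := by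
    simp only [Matrix.inv_def, Ring.inverse_eq_inv']
    have hdet : ContinuousAt (fun x : Joint p m => (meanJacobian s g x.fst x.snd).det) x :=
      (continuous_id.matrix_det).continuousAt.comp hM
    refine (hdet.inv₀ ((Matrix.isUnit_iff_isUnit_det _).1 hE).ne_zero).smul ?_
    exact (continuous_id.matrix_adjugate).continuousAt.comp hM
  have hJ : ContinuousAt (fun x : Joint p m => Jmat s g x.fst x.snd) x :=
    ((continuous_fst.matrix_mul continuous_snd).continuousAt.comp (hI.prodMk hH)).neg
  have hc : Continuous fun J : Matrix (Fin p) (Fin m) ℝ => √((J * J.transpose + 1).det) := by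
    fun_prop
  exact hc.continuousAt.comp hJ

/-! ### Measurability of the constraint set and of its projections -/

variable {B : Set (Vec p)} {T : Set (Vec m)}

theorem continuousAt_moment {x : Joint p m} (h : ∀ j, ContDiffAt ℝ 1 (g (s j)) x.fst) :
    ContinuousAt (moment s g) x := by
  refine tendsto_finsetSum _ fun j _ => Tendsto.smul ?_ ?_
  · exact (continuousAt_prob x.snd j).comp
      (WithLp.sndL 2 ℝ (Vec p) (Vec m)).continuous.continuousAt
  · exact (h j).continuousAt.comp (WithLp.fstL 2 ℝ (Vec p) (Vec m)).continuous.continuousAt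

theorem measurableSet_constraintSet (hB : MeasurableSet B) (hT : MeasurableSet T)
    (hg : ∀ j, ∀ b ∈ B, ContDiffAt ℝ 1 (g (s j)) b) :
    MeasurableSet (constraintSet s g B T) := by
  have hfst : Measurable (fun x : Joint p m => x.fst) :=
    (WithLp.fstL 2 ℝ (Vec p) (Vec m)).continuous.measurable
  have hsnd : Measurable (fun x : Joint p m => x.snd) :=
    (WithLp.sndL 2 ℝ (Vec p) (Vec m)).continuous.measurable
  let R : Set (Joint p m) := (fun x => x.fst) ⁻¹' B ∩ (fun x => x.snd) ⁻¹' T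
  have hR : MeasurableSet R := (hfst hB).inter (hsnd hT)
  -- Continuity is known only over B × T, so the zero set is relatively closed in this Borel set.
  have hc : ContinuousOn (moment s g) R := fun x hx =>
    (continuousAt_moment fun j => hg j _ hx.1).continuousWithinAt
  obtain ⟨u, hu, hu'⟩ := continuousOn_iff_isClosed.1 hc {0} isClosed_singleton
  have : constraintSet s g B T = u ∩ R := by
    rw [← hu']
    ext x
    simp only [constraintSet, R, moment, mem_ofPred_eq, mem_inter_iff, mem_preimage,
      mem_singleton_iff]
    tauto
  rw [this]
  exact hu.measurableSet.inter hR

variable {β : Vec m → Vec p}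

theorem continuous_snd_joint : Continuous fun x : Joint p m => x.snd :=
  (WithLp.sndL 2 ℝ (Vec p) (Vec m)).continuous

theorem mkPair_eq_of_mem (huniq : ∀ θ ∈ T, ∃! b, mkPair b θ ∈ constraintSet s g B T)
    (hβ : ∀ θ ∈ T, mkPair (β θ) θ ∈ constraintSet s g B T) {x : Joint p m}
    (hx : x ∈ constraintSet s g B T) : mkPair (β x.snd) x.snd = x := by
  have h : β x.snd = x.fst := (huniq x.snd hx.2.1).unique (hβ _ hx.2.1) hx
  rw [h]
  rfl

/-- Trades preimages under θ ↦ (β(θ), θ), about which no regularity is known, for images under the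
continuous projection. -/
theorem inter_preimage_mkPair (huniq : ∀ θ ∈ T, ∃! b, mkPair b θ ∈ constraintSet s g B T)
    (hβ : ∀ θ ∈ T, mkPair (β θ) θ ∈ constraintSet s g B T) (A : Set (Joint p m)) :
    (fun θ => mkPair (β θ) θ) ⁻¹' A ∩ T =
      (fun x => x.snd) '' (A ∩ constraintSet s g B T) := by
  ext θ
  constructor
  · rintro ⟨h1, h2⟩
    exact ⟨_, ⟨h1, hβ θ h2⟩, rfl⟩
  · rintro ⟨x, ⟨h1, h2⟩, rfl⟩
    refine ⟨?_, h2.2.1⟩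
    rw [mem_preimage, mkPair_eq_of_mem huniq hβ h2]
    exact h1

/-- Lusin–Souslin: an injective continuous image of a Borel set is Borel. Uniqueness of β given θ
makes the projection injective. -/
theorem measurableSet_image_snd (huniq : ∀ θ ∈ T, ∃! b, mkPair b θ ∈ constraintSet s g B T)
    {A : Set (Joint p m)} (hA : MeasurableSet A) (hAS : A ⊆ constraintSet s g B T) :
    MeasurableSet ((fun x => x.snd) '' A) := by
  refine hA.image_of_continuousOn_injOn continuous_snd_joint.continuousOn fun x hx y hy hxy => ?_
  have hxy' : x.snd = y.snd := hxy
  have hx' := hAS hx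
  have hy' : mkPair y.fst x.snd ∈ constraintSet s g B T := by
    rw [hxy']
    exact hAS hy
  have h : x.fst = y.fst := (huniq x.snd hx'.2.1).unique hx' hy'
  calc x = mkPair x.fst x.snd := rfl
    _ = mkPair y.fst y.snd := by rw [h, hxy']
    _ = y := rfl

theorem aemeasurable_mkPair (hT : MeasurableSet T) (hS : MeasurableSet (constraintSet s g B T))
    (huniq : ∀ θ ∈ T, ∃! b, mkPair b θ ∈ constraintSet s g B T)
    (hβ : ∀ θ ∈ T, mkPair (β θ) θ ∈ constraintSet s g B T) :
    AEMeasurable (fun θ => mkPair (β θ) θ) (volume.restrict T) := by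
  rw [aemeasurable_restrict_iff_comap_subtype hT]
  refine Measurable.aemeasurable fun A hA => ?_
  have h : (fun θ => mkPair (β θ) θ) ∘ ((↑) : T → Vec m) ⁻¹' A =
      (↑) ⁻¹' ((fun x : Joint p m => x.snd) '' (A ∩ constraintSet s g B T)) := by
    rw [← inter_preimage_mkPair huniq hβ]
    ext θ
    simp
  rw [h]
  exact measurable_subtype_coe (measurableSet_image_snd huniq (hA.inter hS) inter_subset_right)

/-- The image of Lebesgue measure on `T` under `θ ↦ (β(θ), θ)`. -/
noncomputable def graphMeasure (β : Vec m → Vec p) (T : Set (Vec m)) : Measure (Joint p m) :=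
  (volume.restrict T).map fun θ => mkPair (β θ) θ

theorem graphMeasure_apply (hT : MeasurableSet T) (hS : MeasurableSet (constraintSet s g B T))
    (huniq : ∀ θ ∈ T, ∃! b, mkPair b θ ∈ constraintSet s g B T)
    (hβ : ∀ θ ∈ T, mkPair (β θ) θ ∈ constraintSet s g B T)
    {A : Set (Joint p m)} (hA : MeasurableSet A) :
    graphMeasure β T A = volume ((fun x => x.snd) '' (A ∩ constraintSet s g B T)) := by
  rw [graphMeasure, Measure.map_apply_of_aemeasurable (aemeasurable_mkPair hT hS huniq hβ) hA,
    Measure.restrict_apply' hT, inter_preimage_mkPair huniq hβ]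

theorem graphMeasure_restrict (hT : MeasurableSet T)
    (hS : MeasurableSet (constraintSet s g B T))
    (huniq : ∀ θ ∈ T, ∃! b, mkPair b θ ∈ constraintSet s g B T)
    (hβ : ∀ θ ∈ T, mkPair (β θ) θ ∈ constraintSet s g B T) :
    (graphMeasure β T).restrict (constraintSet s g B T) = graphMeasure β T := by
  ext A hA
  rw [Measure.restrict_apply hA, graphMeasure_apply hT hS huniq hβ hA,
    graphMeasure_apply hT hS huniq hβ (hA.inter hS), inter_assoc, inter_self]

/-! ### The area formula -/

/-- The power pays for the distortion of n-dimensional Hausdorff measure, the extra factor for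
freezing the volume factor at one point. -/
theorem exists_small_pow {t : NNReal} (ht : 1 < t) (n : ℕ) :
    ∃ δ : NNReal, 0 < δ ∧ (1 + δ) ^ n * (1 + δ) ≤ t := by
  have h : Tendsto (fun δ : NNReal => (1 + δ) ^ n * (1 + δ)) (𝓝[>] 0) (𝓝 1) := by
    have : Continuous fun δ : NNReal => (1 + δ) ^ n * (1 + δ) := by fun_prop
    simpa using (this.tendsto 0).mono_left (nhdsWithin_le_nhds (s := Ioi 0))
  obtain ⟨δ, h1, h2⟩ := ((h.eventually (gt_mem_nhds ht)).and self_mem_nhdsWithin).exists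
  exact ⟨δ, h2, h1.le⟩

theorem exists_nhds_hausdorff_near_image_snd {x₀ : Joint p m}
    (hg : ∀ j, ContDiffAt ℝ 1 (g (s j)) x₀.fst)
    (hE : IsUnit (meanJacobian s g x₀.fst x₀.snd)) {δ : NNReal} (hδ : 0 < δ) :
    ∃ U ∈ 𝓝 x₀, ∀ A ⊆ U, (∀ x ∈ A, moment s g x = 0) →
      μHE[m] A ≤ ((1 + δ : NNReal) : ℝ≥0∞) ^ m *
        (ENNReal.ofReal (volumeFactor s g x₀) * volume ((fun x => x.snd) '' A)) ∧
      ENNReal.ofReal (volumeFactor s g x₀) * volume ((fun x => x.snd) '' A) ≤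
        ((1 + δ : NNReal) : ℝ≥0∞) ^ m * μHE[m] A := by
  have hev := eventually_norm_sub_Jmat_le hg hE (NNReal.coe_pos.2 hδ)
  rw [nhds_prod_eq] at hev
  obtain ⟨U, hU, hUq⟩ := mem_prod_same_iff.1 hev
  refine ⟨U, hU, fun A hAU hA => ?_⟩
  have hk := euclideanHausdorffMeasure_near_graph (δ := δ) (s := A)
    (Matrix.toEuclideanLin (Jmat s g x₀.fst x₀.snd)) fun x hx y hy => by
      have h := hUq (mk_mem_prod (hAU hx) (hAU hy))
      rw [mem_ofPred_eq] at h
      exact h (hA x hx) (hA y hy)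
  rwa [← volumeFactor_eq_normDet, finrank_euclideanSpace_fin] at hk

/-- Near each of its points, the constraint set has Hausdorff measure close to the volume of its
projection, weighted by the volume factor. -/
theorem exists_nhds_hausdorff_near (hT : MeasurableSet T)
    (hS : MeasurableSet (constraintSet s g B T))
    (hg : ∀ j, ∀ b ∈ B, ContDiffAt ℝ 1 (g (s j)) b)
    (hE : ∀ b θ, mkPair b θ ∈ constraintSet s g B T → IsUnit (meanJacobian s g b θ))
    (huniq : ∀ θ ∈ T, ∃! b, mkPair b θ ∈ constraintSet s g B T)
    (hβ : ∀ θ ∈ T, mkPair (β θ) θ ∈ constraintSet s g B T)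
    {t : NNReal} (ht : 1 < t) {x₀ : Joint p m} (hx₀ : x₀ ∈ constraintSet s g B T) :
    ∃ W ∈ 𝓝 x₀, ∀ A, MeasurableSet A → A ⊆ W ∩ constraintSet s g B T →
      μHE[m] A ≤ t * (graphMeasure β T).withDensity
        (fun x => ENNReal.ofReal (volumeFactor s g x)) A ∧
      (graphMeasure β T).withDensity (fun x => ENNReal.ofReal (volumeFactor s g x)) A ≤
        t * μHE[m] A := by
  obtain ⟨δ, hδ, hδt⟩ := exists_small_pow ht m
  have hg₀ : ∀ j, ContDiffAt ℝ 1 (g (s j)) x₀.fst := fun j => hg j _ hx₀.1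
  have hE₀ : IsUnit (meanJacobian s g x₀.fst x₀.snd) := hE _ _ hx₀
  have hc := continuousAt_volumeFactor hg₀ hE₀
  have hc₀ : 0 < volumeFactor s g x₀ := volumeFactor_pos x₀
  have hδ' : (0 : ℝ) < δ := hδ
  obtain ⟨U, hU, hUA⟩ := exists_nhds_hausdorff_near_image_snd hg₀ hE₀ hδ
  have h1 : ∀ᶠ x in 𝓝 x₀, volumeFactor s g x < (1 + δ) * volumeFactor s g x₀ :=
    hc.eventually (gt_mem_nhds (by nlinarith))
  have h2 : ∀ᶠ x in 𝓝 x₀, volumeFactor s g x₀ < (1 + δ) * volumeFactor s g x :=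
    (hc.const_mul (1 + (δ : ℝ))).eventually (lt_mem_nhds (by nlinarith))
  refine ⟨_, inter_mem hU (inter_mem h1 h2), fun A hA hAW => ?_⟩
  have hAS : A ⊆ constraintSet s g B T := fun x hx => (hAW hx).2
  have hκ : graphMeasure β T A = volume ((fun x => x.snd) '' A) := by
    rw [graphMeasure_apply hT hS huniq hβ hA, inter_eq_left.2 hAS]
  obtain ⟨k1, k2⟩ := hUA A (fun x hx => (hAW hx).1.1) fun x hx => (hAS hx).2.2
  rw [← hκ] at k1 k2
  rw [withDensity_apply _ hA]
  have htδ : ((1 + δ : NNReal) : ℝ≥0∞) ^ m * ((1 + δ : NNReal) : ℝ≥0∞) ≤ t := by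
    exact_mod_cast hδt
  have hmul : ∀ r : ℝ, ENNReal.ofReal ((1 + δ) * r) =
      ((1 + δ : NNReal) : ℝ≥0∞) * ENNReal.ofReal r := by
    intro r
    rw [ENNReal.ofReal_mul (by positivity), ← ENNReal.ofReal_coe_nnreal]
    simp
  have i1 : ENNReal.ofReal (volumeFactor s g x₀) * graphMeasure β T A ≤
      ((1 + δ : NNReal) : ℝ≥0∞) * ∫⁻ x in A, ENNReal.ofReal (volumeFactor s g x)
        ∂graphMeasure β T := by
    rw [← setLIntegral_const, ← lintegral_const_mul' _ _ ENNReal.coe_ne_top]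
    refine setLIntegral_mono' hA fun x hx => ?_
    rw [← hmul]
    exact ENNReal.ofReal_le_ofReal (hAW hx).1.2.2.le
  have i2 : ∫⁻ x in A, ENNReal.ofReal (volumeFactor s g x) ∂graphMeasure β T ≤
      ((1 + δ : NNReal) : ℝ≥0∞) *
        (ENNReal.ofReal (volumeFactor s g x₀) * graphMeasure β T A) := by
    rw [← mul_assoc, ← hmul, ← setLIntegral_const]
    refine setLIntegral_mono' hA fun x hx => ?_
    exact ENNReal.ofReal_le_ofReal (hAW hx).1.2.1.le
  constructor
  · refine k1.trans ((mul_le_mul_right i1 _).trans ?_)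
    rw [← mul_assoc]
    gcongr
  · refine i2.trans ((mul_le_mul_right k2 _).trans ?_)
    rw [← mul_assoc, mul_comm ((1 + δ : NNReal) : ℝ≥0∞)]
    gcongr

/-- Area formula for the constraint set. -/
theorem euclideanHausdorffMeasure_restrict_constraintSet (hT : MeasurableSet T)
    (hS : MeasurableSet (constraintSet s g B T))
    (hg : ∀ j, ∀ b ∈ B, ContDiffAt ℝ 1 (g (s j)) b)
    (hE : ∀ b θ, mkPair b θ ∈ constraintSet s g B T → IsUnit (meanJacobian s g b θ))
    (huniq : ∀ θ ∈ T, ∃! b, mkPair b θ ∈ constraintSet s g B T)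
    (hβ : ∀ θ ∈ T, mkPair (β θ) θ ∈ constraintSet s g B T) :
    (μHE[m] : Measure (Joint p m)).restrict (constraintSet s g B T) =
      (graphMeasure β T).withDensity fun x => ENNReal.ofReal (volumeFactor s g x) := by
  have h : ((graphMeasure β T).withDensity fun x => ENNReal.ofReal (volumeFactor s g x)).restrict
      (constraintSet s g B T) =
      (graphMeasure β T).withDensity fun x => ENNReal.ofReal (volumeFactor s g x) := by
    rw [restrict_withDensity hS, graphMeasure_restrict hT hS huniq hβ]
  rw [← h]
  refine le_antisymm (Measure.restrict_le_of_locally_le_mul hS fun t ht x hx => ?_)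
    (Measure.restrict_le_of_locally_le_mul hS fun t ht x hx => ?_)
  · obtain ⟨W, hW, hA⟩ := exists_nhds_hausdorff_near hT hS hg hE huniq hβ ht hx
    exact ⟨W, hW, fun A hAm hAW => (hA A hAm hAW).1⟩
  · obtain ⟨W, hW, hA⟩ := exists_nhds_hausdorff_near hT hS hg hE huniq hβ ht hx
    exact ⟨W, hW, fun A hAm hAW => (hA A hAm hAW).2⟩

/-! ### The marginal density of θ -/

theorem hasDensity_map_snd (hT : MeasurableSet T)
    (hS : MeasurableSet (constraintSet s g B T))
    (hg : ∀ j, ∀ b ∈ B, ContDiffAt ℝ 1 (g (s j)) b)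
    (hE : ∀ b θ, mkPair b θ ∈ constraintSet s g B T → IsUnit (meanJacobian s g b θ))
    (huniq : ∀ θ ∈ T, ∃! b, mkPair b θ ∈ constraintSet s g B T)
    (hβ : ∀ θ ∈ T, mkPair (β θ) θ ∈ constraintSet s g B T)
    {μ : Measure (Joint p m)} {f : Joint p m → ℝ}
    (hf : HasDensity μ (μHE[m].restrict (constraintSet s g B T)) f) :
    HasDensity (μ.map fun x => x.snd) volume
      (T.indicator fun θ => volumeFactor s g (mkPair (β θ) θ) * f (mkPair (β θ) θ)) := by
  obtain ⟨hfm, hf0, rfl⟩ := hf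
  have hσ := aemeasurable_mkPair hT hS huniq hβ
  have hcm : AEMeasurable (volumeFactor s g) (graphMeasure β T) := by
    rw [← graphMeasure_restrict hT hS huniq hβ]
    refine ContinuousOn.aemeasurable (fun x hx => ?_) hS
    exact (continuousAt_volumeFactor (fun j => hg j _ hx.1) (hE _ _ hx)).continuousWithinAt
  -- The volume factor is positive, so the area formula can be reversed for null sets; this carries
  -- measurability and nonnegativity of f over to the graph measure.
  have hac : graphMeasure β T ≪ μHE[m].restrict (constraintSet s g B T) := by
    rw [euclideanHausdorffMeasure_restrict_constraintSet hT hS hg hE huniq hβ]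
    exact withDensity_absolutelyContinuous' hcm.ennreal_ofReal
      (Eventually.of_forall fun x => (ENNReal.ofReal_pos.2 (volumeFactor_pos x)).ne')
  have hfκ : AEMeasurable f (graphMeasure β T) := hfm.mono_ac hac
  have hf0κ : 0 ≤ᵐ[graphMeasure β T] f := hac.ae_le hf0
  have hprod : AEMeasurable (fun θ => volumeFactor s g (mkPair (β θ) θ) * f (mkPair (β θ) θ))
      (volume.restrict T) := (hcm.mul hfκ).comp_aemeasurable hσ
  refine ⟨(aemeasurable_indicator_iff hT).2 hprod, ?_, ?_⟩
  · have h1 : ∀ᵐ θ ∂volume.restrict T, 0 ≤ f (mkPair (β θ) θ) := ae_of_ae_map hσ hf0κ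
    rw [ae_restrict_iff' hT] at h1
    filter_upwards [h1] with θ hθ
    by_cases h : θ ∈ T
    · simpa [h] using mul_nonneg (volumeFactor_pos (mkPair (β θ) θ)).le (hθ h)
    · simp [h]
  · rw [euclideanHausdorffMeasure_restrict_constraintSet hT hS hg hE huniq hβ,
      ← withDensity_mul₀ hcm.ennreal_ofReal hfκ.ennreal_ofReal]
    have hsnd := (continuous_snd_joint (p := p) (m := m)).measurable
    ext C hC
    rw [Measure.map_apply hsnd hC, withDensity_apply _ (hsnd hC), withDensity_apply _ hC,
      ← lintegral_indicator (hsnd hC), graphMeasure, lintegral_map' ?_ hσ]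
    · rw [← lintegral_indicator hC, ← lintegral_indicator hT]
      refine lintegral_congr fun θ => ?_
      by_cases h1 : θ ∈ T <;> by_cases h2 : θ ∈ C <;>
        simp [h1, h2, indicator, ENNReal.ofReal_mul (volumeFactor_pos _).le]
    · exact ((hcm.ennreal_ofReal.mul hfκ.ennreal_ofReal)).indicator (hsnd hC)

/-! ### Continuity and differentiability of β(θ) -/

/-- The map (G, θ) has a surjective strict derivative, so it is open at the given zero: every nearby
θ has a zero with β close to β(θ₀). Interiority puts that β in B, and uniqueness identifies it with
β(θ). -/
theorem continuousWithinAt_of_mem_interior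
    (hg : ∀ j, ∀ b ∈ B, ContDiffAt ℝ 1 (g (s j)) b)
    (hE : ∀ b θ, mkPair b θ ∈ constraintSet s g B T → IsUnit (meanJacobian s g b θ))
    (huniq : ∀ θ ∈ T, ∃! b, mkPair b θ ∈ constraintSet s g B T)
    (hβ : ∀ θ ∈ T, mkPair (β θ) θ ∈ constraintSet s g B T)
    {θ₀ : Vec m} (hθ₀ : θ₀ ∈ T) (hint : β θ₀ ∈ interior B) : ContinuousWithinAt β T θ₀ := by
  set x₀ : Joint p m := mkPair (β θ₀) θ₀ with hx₀
  have hmem : x₀ ∈ constraintSet s g B T := hβ θ₀ hθ₀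
  have hE₀ : IsUnit (meanJacobian s g x₀.fst x₀.snd) := hE _ _ hmem
  have hG := hasStrictFDerivAt_moment (s := s) (g := g) (x := x₀) fun j => hg j _ hmem.1
  have hΦ := hG.prodMk (WithLp.sndL 2 ℝ (Vec p) (Vec m)).hasStrictFDerivAt
  have hsurj : ((momentDeriv s g x₀).prod (WithLp.sndL 2 ℝ (Vec p) (Vec m))).range = ⊤ := by
    refine LinearMap.range_eq_top.2 fun ⟨a, θ⟩ => ?_
    -- The derivative is block triangular: θ is prescribed, and E b = a - H θ is solved for b.
    obtain ⟨b, hb⟩ := surjective_meanJacobian hE₀ (a - Matrix.toEuclideanLin (Hmat s g x₀.fst) θ)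
    refine ⟨mkPair b θ, Prod.ext ?_ rfl⟩
    change momentDeriv s g x₀ (mkPair b θ) = a
    rw [momentDeriv_apply]
    change Matrix.toEuclideanLin (meanJacobian s g x₀.fst x₀.snd) b +
      Matrix.toEuclideanLin (Hmat s g x₀.fst) θ = a
    rw [hb, sub_add_cancel]
  have hmap := hΦ.map_nhds_eq_of_surj hsurj
  rw [ContinuousWithinAt, tendsto_def]
  intro U hU
  have hV : (fun x : Joint p m => x.fst) ⁻¹' (U ∩ B) ∈ 𝓝 x₀ :=
    (WithLp.fstL 2 ℝ (Vec p) (Vec m)).continuous.continuousAt.preimage_mem_nhds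
      (inter_mem hU (mem_interior_iff_mem_nhds.1 hint))
  have himg : (fun x : Joint p m => (moment s g x, x.snd)) ''
      ((fun x : Joint p m => x.fst) ⁻¹' (U ∩ B)) ∈ 𝓝 ((0 : Vec p), θ₀) := by
    have h0 : moment s g x₀ = 0 := hmem.2.2
    have h := image_mem_map (m := fun x : Joint p m => (moment s g x, x.snd)) hV
    rw [← h0]
    exact hmap ▸ h
  have hθ : ∀ᶠ θ in 𝓝 θ₀, ((0 : Vec p), θ) ∈ (fun x : Joint p m => (moment s g x, x.snd)) ''
      ((fun x : Joint p m => x.fst) ⁻¹' (U ∩ B)) :=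
    (Continuous.prodMk_right (0 : Vec p)).continuousAt.eventually himg
  filter_upwards [nhdsWithin_le_nhds hθ, self_mem_nhdsWithin] with θ h1 hθT
  obtain ⟨x, hx, hxθ⟩ := h1
  have hx0 : moment s g x = 0 := congrArg Prod.fst hxθ
  have hxs : x.snd = θ := congrArg Prod.snd hxθ
  have hxS : x ∈ constraintSet s g B T := ⟨hx.2, hxs ▸ hθT, hx0⟩
  have h := congrArg (fun x : Joint p m => x.fst) (mkPair_eq_of_mem huniq hβ hxS)
  have h' : β θ = x.fst := hxs ▸ h
  rw [mem_preimage, h']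
  exact hx.1

/-- The two-point estimate with its second zero fixed at (β(θ₀), θ₀); continuity keeps the first
zero in the neighbourhood where the estimate holds. -/
theorem hasFDerivWithinAt_of_continuousWithinAt
    (hg : ∀ j, ∀ b ∈ B, ContDiffAt ℝ 1 (g (s j)) b)
    (hE : ∀ b θ, mkPair b θ ∈ constraintSet s g B T → IsUnit (meanJacobian s g b θ))
    (hβ : ∀ θ ∈ T, mkPair (β θ) θ ∈ constraintSet s g B T)
    {θ₀ : Vec m} (hθ₀ : θ₀ ∈ T) (hc : ContinuousWithinAt β T θ₀) :
    HasFDerivWithinAt β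
      (LinearMap.toContinuousLinearMap (Matrix.toEuclideanLin (Jmat s g (β θ₀) θ₀))) T θ₀ := by
  have hmem : mkPair (β θ₀) θ₀ ∈ constraintSet s g B T := hβ θ₀ hθ₀
  refine HasFDerivWithinAt.of_isLittleO (Asymptotics.IsLittleO.of_bound fun ε hε => ?_)
  have hev := eventually_norm_sub_Jmat_le (s := s) (g := g) (x₀ := mkPair (β θ₀) θ₀)
    (fun j => hg j _ hmem.1) (hE _ _ hmem) hε
  have hσ : Tendsto (fun θ => (mkPair (β θ) θ, mkPair (β θ₀) θ₀)) (𝓝[T] θ₀)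
      (𝓝 (mkPair (β θ₀) θ₀, mkPair (β θ₀) θ₀)) := by
    refine Tendsto.prodMk_nhds ?_ tendsto_const_nhds
    exact ((WithLp.prod_continuous_toLp 2 (Vec p) (Vec m)).tendsto _).comp
      (hc.tendsto.prodMk_nhds (tendsto_id.mono_left nhdsWithin_le_nhds))
  filter_upwards [hσ.eventually hev, self_mem_nhdsWithin] with θ h1 h2
  exact h1 (hβ θ h2).2.2 hmem.2.2

end MomentModel

end

open MomentModel in
theorem proposition1 {d p m : ℕ}
    (s : Fin (m + 1) → Vec d) (g : Vec d → Vec p → Vec p)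
    (B : Set (Vec p)) (hB : MeasurableSet B)
    (T : Set (Vec m)) (hT : MeasurableSet T) (hTsub : T ⊆ simplex m)
    (hg : ∀ j, ∀ b ∈ B, ContDiffAt ℝ 1 (g (s j)) b)
    (hE : ∀ b θ, mkPair b θ ∈ constraintSet s g B T → IsUnit (meanJacobian s g b θ))
    (huniq : ∀ θ ∈ T, ∃! b, mkPair b θ ∈ constraintSet s g B T)
    (β : Vec m → Vec p) (hβ : ∀ θ ∈ T, mkPair (β θ) θ ∈ constraintSet s g B T)
    (μ : Measure (Joint p m)) (f : Joint p m → ℝ)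
    (hf : HasDensity μ (μHE[m].restrict (constraintSet s g B T)) f) :
    (∀ θ ∈ T, (β θ ∈ interior B ∨ ContinuousWithinAt β T θ) →
      HasFDerivWithinAt β
        (LinearMap.toContinuousLinearMap (Matrix.toEuclideanLin (Jmat s g (β θ) θ))) T θ) ∧
    HasDensity (μ.map fun x => x.snd) volume
      (T.indicator fun θ =>
        √((Jmat s g (β θ) θ * (Jmat s g (β θ) θ).transpose + 1).det) *
          f (mkPair (β θ) θ)) := by
  have hS := measurableSet_constraintSet hB hT hg
  refine ⟨fun θ hθ h => ?_, hasDensity_map_snd hT hS hg hE huniq hβ hf⟩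
  exact hasFDerivWithinAt_of_continuousWithinAt hg hE hβ hθ
    (h.elim (continuousWithinAt_of_mem_interior hg hE huniq hβ hθ) id)
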